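/- Kernel Esterel statements without loops, over a set $S$ of signals, are \[ p ::= \mathtt{nothing}\mid\mathtt{pause}\mid\mathtt{exit}\,n\mid\mathtt{emit}\,s\mid\mathtt{await\ immediate}\,s\mid\mathtt{trap}\,p\mid\mathtt{shift}\,p\mid\mathtt{suspend}\,s\,p\mid\mathtt{if}\,s\,p\,q\mid p;q\mid p\parallel q\mid\mathtt{signal}\,s\,p . \] A Scott boolean is $\bot$, $+$ or $-$, with $\bot<+$ and $\bot<-$; $\neg,\wedge,\vee$ are the (parallel, strong Kleene) gates. An input color is a triple $(Go,Res,Susp)$ of Scott booleans, ordered componentwise. An output color is $\mathrm{black}\,k$ ($k\in\mathbb N$) or $\mathrm{white}\,K$ ($K\subset\mathbb N$ finite), ordered by $\mathrm{white}\,K\le\mathrm{white}\,L\iff L\subseteq K$, $\mathrm{white}\,K\le\mathrm{black}\,k\iff k\in K$, $\mathrm{black}\,k\le\mathrm{black}\,l\iff k=l$, and never $\mathrm{black}\,k\le\mathrm{white}\,K$. A microstate $p$ is a statement in which every sub-statement (itself included) is annotated by a boolean $Sel$, an input color and an output color; $in(p)$, $out(p)$ and $Sel(p)$ are the outermost annotations,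 the command of $p$ is $p$ without its outermost annotations, $base(p)$ is the statement without any annotation, and $p[in:=i]$ is $p$ with its outermost input color replaced by $i$. One puts $p\le q$ if $p$ and $q$ have the same base statement and the same $Sel$ values and every color in $p$ is $\le$ the corresponding one in $q$; $p<q$ means $p\le q$ and not $q\le p$. A microstate is total if no input color in it contains $\bot$ and every output color in it is $\mathrm{white}\,\emptyset$ or some $\mathrm{black}\,k$. An event $E$ is a partial map from signals to Scott booleans, $E(s)$ being $\bot$ if $s\notin\mathrm{dom}\,E$. Fix an arbitrary function $synch(sel_1,sel_2,out_1,out_2)$ into output colors, the synchronizer (usually: the maximum of two known codes, and the other color if one of the two is $\mathrm{white}\,\emptyset$). The microstep relation $E\vdash p\to p'$ is the least relation closed under the following rules, where $i$, $o$ and $Sel$ are the outermost annotations of the left-hand side (kept unless the rule says otherwise), $Go,Res,Susp$ are the wires of $i$, "$out:=x$" replaces $o$ by $x$, and "$p.w:=x$" replaces the wire $w$ of $in(p)$ by $x$ for a sub-microstate $p$. * $\mathtt{nothing}$ and $\mathtt{emit}\,s$ with code $c=0$, $\mathtt{exit}\,n$ with code $c=n+2$: if $o=\mathrm{white}\{c\}$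 and $Sel=-$, then $out:=\mathrm{white}\,\emptyset$ when $Go=-$, and $out:=\mathrm{black}\,c$ when $Go=+$. * $\mathtt{pause}$: if $o=\mathrm{white}\,K$, $0\in K$ and ($Res=-$ or $Sel=-$), $out:=\mathrm{white}(K\setminus 0)$; if $o=\mathrm{white}\,K$, $1\in K$ and $Go=-$, $out:=\mathrm{white}(K\setminus 1)$; if $Go=+$ and $o<\mathrm{black}\,1$, $out:=\mathrm{black}\,1$; if $Sel=+$, $Res=+$, $Susp=-$ and $o<\mathrm{black}\,0$, $out:=\mathrm{black}\,0$. * $\mathtt{await\ immediate}\,s$: call it executed if $Go=+$ or ($Sel=+$ and $Res=+$), not executed if $Go=-$ and ($Sel=-$ or $Res=-$). If $o=\mathrm{white}\,K$, then $out:=\mathrm{white}(K\setminus 0)$ when $0\in K$ and (not executed or $E(s)=-$), and $out:=\mathrm{white}(K\setminus 1)$ when $1\in K$ and (not executed or $E(s)=+$). If executed: $out:=\mathrm{black}\,1$ when $E(s)=-$ and $o<\mathrm{black}\,1$; $out:=\mathrm{black}\,0$ when $E(s)=+$ and $o<\mathrm{black}\,0$. * Start rules. Each of the following assignments may be made if the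 new value of the wire (or input color) is strictly larger than the old one. $\mathtt{trap}\,p$, $\mathtt{shift}\,p$, $\mathtt{signal}\,s\,p$: $in(p):=i$. $p\parallel q$: $in(p):=i$; $in(q):=i$. $\mathtt{suspend}\,s\,p$: $p.Go:=Go$; $p.Res:=Res\wedge Sel(p)\wedge\neg E(s)$; $p.Susp:=susp$, where $susp=Susp\vee(Res\wedge Sel(p)\wedge E(s))$. $\mathtt{if}\,s\,p\,q$: $p.Go:=Go\wedge E(s)$; $q.Go:=Go\wedge\neg E(s)$; $p.Res:=Res$; $q.Res:=Res$; $p.Susp:=Susp$; $q.Susp:=Susp$. $p;q$: $in(p):=i$; $q.Res:=Res$; $q.Susp:=Susp$. Moreover in $p;q$, if $q.Go=\bot$: $q.Go:=+$ when $out(p)=\mathrm{black}\,0$, and $q.Go:=-$ when $out(p)\not\le\mathrm{black}\,0$. * Context rules: a sub-microstate may make a microstep in the same event $E$, except that in $\mathtt{signal}\,s\,p$ the body makes a microstep in $E$ updated by $s\mapsto b$, where $b=+$ if some emitter of (this) $s$ in $p$ has output color $\mathrm{black}\,0$, $b=-$ if all of them have $\mathrm{white}\,\emptyset$, and $b=\bot$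 otherwise. * End rules: $out:=x$ may be done if $o<x$, where $x$ is: for $\mathtt{trap}\,p$ (resp. $\mathtt{shift}\,p$), $out(p)$ with codes renumbered by $0\mapsto0,\,1\mapsto1,\,2\mapsto0,\,k\mapsto k-1$ for $k>2$ (resp. $k\mapsto k+1$ for $k\ge2$, $0$ and $1$ fixed); for $\mathtt{suspend}\,s\,p$, $N(\bot,out(p))$ or $N(susp,out(p))$; for $\mathtt{if}\,s\,p\,q$, $out(p)\cup out(q)$; for $p;q$, $(out(p)\setminus0)\cup out(q)$; for $p\parallel q$, $synch(Sel(p),Sel(q),out(p),out(q))$; for $\mathtt{signal}\,s\,p$, $out(p)$. Here $\mathrm{white}\,K\cup\mathrm{white}\,L=\mathrm{white}(K\cup L)$, $\mathrm{black}\,k\cup\mathrm{white}\,K=\mathrm{white}\,K\cup\mathrm{black}\,k=\mathrm{black}\,k$ and, by convention, $\mathrm{black}\,k\cup\mathrm{black}\,l=\mathrm{black}\max(k,l)$; $\mathrm{white}\,K\setminus0=\mathrm{white}(K\setminus\{0\})$, $\mathrm{black}\,0\setminus0=\mathrm{white}\,\emptyset$, $\mathrm{black}\,k\setminus0=\mathrm{black}\,k$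 for $k\ne0$; $N(-,o)=o$; $N(+,\mathrm{white}\,\emptyset)=\mathrm{black}\,1$, $N(+,\mathrm{black}\,k)=\mathrm{black}\max(1,k)$, $N(+,\mathrm{white}\,K)=\mathrm{white}(\{1\}\cup K\setminus\{0\})$ for $K\neq\emptyset$; $N(\bot,\mathrm{black}\,0)=\mathrm{white}\{0,1\}$, and $N(\bot,o)=\mathrm{white}\{1\}\cup o$ otherwise. **Theorem.** For every synchronizer, every event $E$ and all microstates $p,p'$: 1. If $E\vdash p\to p'$, then $base(p)=base(p')$ and $p$ and $p'$ have the same $Sel$ values. 2. If $E\vdash p\to p'$, then $in(p)=in(p')$. 3. If $E\vdash p\to p'$, then $p<p'$. Consequently, if $p$ is total, there is no $p'$ with $E\vdash p\to p'$. 4. If $E\vdash p\to p'$, then $p$ and $p'$ have the same command or $out(p)=out(p')$. 5. If $E\vdash p\to p'$ and $in(p)<i$, then there is $p''$ with $E\vdash p[in:=i]\to p''$, $p'<p''$ and $E\vdash p'[in:=i]\to^* p''$ (reflexive transitive closure). The same holds with $\le$ instead of $<$ in both places. -/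

import Mathlib

namespace Esterel

universe u

/-! ### Wires and colors -/

/-- Scott booleans: the value of a wire, `bot` meaning that it is not known yet. -/
inductive SBool where
  | bot
  | pos
  | neg
  deriving DecidableEq

namespace SBool

/-- The flat (information) order: `bot < pos` and `bot < neg`. -/
instance : PartialOrder SBool where
  le a b := a = bot ∨ a = b
  le_refl _ := Or.inr rfl
  le_trans a b c h₁ h₂ := by
    rcases h₁ with h | h
    · exact Or.inl h
    · exact h ▸ h₂
  le_antisymm a b h₁ h₂ := by
    rcases h₁ with h | h
    · rcases h₂ with h' | h'
      · rw [h, h']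
      · exact h'.symm
    · exact h

/-- The value of a wire carrying a known boolean. -/
def ofBool : Bool → SBool
  | true => pos
  | false => neg

def not : SBool → SBool
  | bot => bot
  | pos => neg
  | neg => pos

/-- The AND gate (it answers `neg` as soon as one of its inputs is `neg`). -/
def and : SBool → SBool → SBool
  | neg, _ => neg
  | _, neg => neg
  | pos, pos => pos
  | _, _ => bot

/-- The OR gate (it answers `pos` as soon as one of its inputs is `pos`). -/
def or : SBool → SBool → SBool
  | pos, _ => pos
  | _, pos => pos
  | neg, neg => neg
  | _, _ => bot

end SBool

/-- Input colors: the wires Go, Res and Susp. -/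
@[ext] structure InColor where
  go : SBool
  res : SBool
  susp : SBool
  deriving DecidableEq

/-- Input colors are ordered componentwise. -/
instance : PartialOrder InColor :=
  PartialOrder.lift (fun i : InColor => (i.go, i.res, i.susp)) (by
    intro i j h
    simp only [Prod.mk.injEq] at h
    exact InColor.ext h.1 h.2.1 h.2.2)

/-- Output colors: `black k` says that the `k`-th return wire is `1`, `white K` that the return
wires outside the finite set `K` are `0` and that no return wire is known to be `1`. -/
inductive OutColor where
  | black (k : ℕ)
  | white (K : Finset ℕ)
  deriving DecidableEq

namespace OutColor

/-- The information order on output colors. -/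
protected def le : OutColor → OutColor → Prop
  | white K, white L => L ⊆ K
  | white K, black k => k ∈ K
  | black k, black l => k = l
  | black _, white _ => False

instance : PartialOrder OutColor where
  le := OutColor.le
  le_refl a := by cases a <;> simp [OutColor.le]
  le_trans a b c h₁ h₂ := by
    cases a <;> cases b <;> cases c <;> simp only [OutColor.le] at h₁ h₂ ⊢
    · exact h₁.trans h₂
    · exact h₂ ▸ h₁
    · exact h₁ h₂
    · exact h₂.trans h₁
  le_antisymm a b h₁ h₂ := by
    cases a <;> cases b <;> simp only [OutColor.le] at h₁ h₂
    · rw [h₁]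
    · rw [Finset.Subset.antisymm h₂ h₁]

/-- Apply a renumbering of the return codes. -/
def map (f : ℕ → ℕ) : OutColor → OutColor
  | black k => black (f k)
  | white K => white (K.image f)

/-- Combination of the return wires of two branches that are never simultaneously executed:
as soon as one branch is known to return `k`, so does the combination. Two distinct known codes
cannot be represented in a one-hot encoding; the value in that unreachable case is a default. -/
def union : OutColor → OutColor → OutColor
  | black k, black l => black (max k l)
  | black k, white _ => black k
  | white _, black l => black l
  | white K, white L => white (K ∪ L)

/-- Remove the return code `0`. -/
def eraseZero : OutColor → OutColor
  | black k => if k = 0 then white ∅ else black k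
  | white K => white (K.erase 0)

end OutColor

/-- Effect of a trap on return codes: `0 ↦ 0`, `1 ↦ 1`, `2 ↦ 0`, and `k ↦ k - 1` for `k > 2`. -/
def codeDown (k : ℕ) : ℕ :=
  if k ≤ 1 then k else if k = 2 then 0 else k - 1

/-- Effect of a shift on return codes: `0 ↦ 0`, `1 ↦ 1`, and `k ↦ k + 1` for `k ≥ 2`. -/
def codeUp (k : ℕ) : ℕ :=
  if k ≤ 1 then k else k + 1

/-- The return code of a suspension, from the status of the suspension and the return code
of its body. -/
def suspNow : SBool → OutColor → OutColor
  | .neg, out => out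
  | .pos, .black k => .black (max 1 k)
  | .pos, .white K => if K = ∅ then .black 1 else .white (insert 1 (K.erase 0))
  | .bot, out => if out = .black 0 then .white {0, 1} else (OutColor.white {1}).union out

/-! ### Synchronizers

The parallel statement computes its return code from the Sel values and the output colors of its
two branches by a synchronizer. No particular implementation is fixed: the microstep relation below
takes the synchronizer as an argument, which may be any function of this type. -/

/-- Synchronizers: `sync sel₁ sel₂ out₁ out₂` is the output color of a parallel statement. -/
abbrev Synchronizer := Bool → Bool → OutColor → OutColor → OutColor

/-- The usual synchronizer takes the maximum of two known return codes, and returns the color of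
the other branch if one branch is dead (`white ∅`). On partial information it gives the most
precise color that is compatible with all the ways of completing the information. -/
def maxSync : Synchronizer
  | _, _, .black k, .black l => .black (max k l)
  | _, _, .black k, .white L =>
      if ∀ l ∈ L, l ≤ k then .black k else .white (insert k (L.filter (k < ·)))
  | _, _, .white K, .black l =>
      if ∀ k ∈ K, k ≤ l then .black l else .white (insert l (K.filter (l < ·)))
  | _, _, .white K, .white L => .white (K ∪ L)

/-! ### Statements and microstates -/

/-- Kernel statements (in symbolic form, over the signals `S`). -/
inductive Stmt (S : Type u) : Type u where
  | nothing
  | pause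
  | exit (n : ℕ)
  | emit (s : S)
  | awaitImm (s : S)
  | trap (p : Stmt S)
  | shift (p : Stmt S)
  | suspend (s : S) (p : Stmt S)
  | ite (s : S) (p q : Stmt S)
  | seq (p q : Stmt S)
  | par (p q : Stmt S)
  | loop (p : Stmt S)
  | signal (s : S) (p : Stmt S)

mutual
/-- Microstates: a Sel value, an input color, an annotated command, an output color. -/
inductive MState (S : Type u) : Type u where
  | colors (sel : Bool) (inp : InColor) (cmd : MCmd S) (out : OutColor)

/-- Annotated commands: the sub-statements are microstates. The return code of `exit n`
is `n + 2`. There are no loops. -/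
inductive MCmd (S : Type u) : Type u where
  | nothing
  | pause
  | exit (n : ℕ)
  | emit (s : S)
  | awaitImm (s : S)
  | trap (p : MState S)
  | shift (p : MState S)
  | suspend (s : S) (p : MState S)
  | ite (s : S) (p q : MState S)
  | seq (p q : MState S)
  | par (p q : MState S)
  | signal (s : S) (p : MState S)
end

section Microstates

variable {S : Type u}

namespace MState

def sel : MState S → Bool
  | colors b _ _ _ => b

def inp : MState S → InColor
  | colors _ i _ _ => i

def cmd : MState S → MCmd S
  | colors _ _ c _ => c

def out : MState S → OutColor
  | colors _ _ _ o => o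

/-- Replace the input color of a microstate (the outermost one only). -/
def setIn (i : InColor) : MState S → MState S
  | colors b _ c o => colors b i c o

/-- Replace the Go wire. -/
def setGo (b : SBool) (p : MState S) : MState S := p.setIn { p.inp with go := b }

/-- Replace the Res wire. -/
def setRes (b : SBool) (p : MState S) : MState S := p.setIn { p.inp with res := b }

/-- Replace the Susp wire. -/
def setSusp (b : SBool) (p : MState S) : MState S := p.setIn { p.inp with susp := b }

end MState

mutual
/-- The base statement: erase all annotations. -/
def MState.base : MState S → Stmt S
  | .colors _ _ c _ => c.base

def MCmd.base : MCmd S → Stmt S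
  | .nothing => .nothing
  | .pause => .pause
  | .exit n => .exit n
  | .emit s => .emit s
  | .awaitImm s => .awaitImm s
  | .trap p => .trap p.base
  | .shift p => .shift p.base
  | .suspend s p => .suspend s p.base
  | .ite s p q => .ite s p.base q.base
  | .seq p q => .seq p.base q.base
  | .par p q => .par p.base q.base
  | .signal s p => .signal s p.base
end

mutual
/-- All the Sel values of a microstate, listed in prefix order. -/
def MState.sels : MState S → List Bool
  | .colors b _ c _ => b :: c.sels

def MCmd.sels : MCmd S → List Bool
  | .nothing => []
  | .pause => []
  | .exit _ => []
  | .emit _ => []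
  | .awaitImm _ => []
  | .trap p => p.sels
  | .shift p => p.sels
  | .suspend _ p => p.sels
  | .ite _ p q => p.sels ++ q.sels
  | .seq p q => p.sels ++ q.sels
  | .par p q => p.sels ++ q.sels
  | .signal _ p => p.sels
end

mutual
/-- The Scott order on microstates: same base statement, same Sel values, and every color of the
first one is below the corresponding color of the second one. -/
def MState.Le : MState S → MState S → Prop
  | .colors b i c o, p' => b = p'.sel ∧ i ≤ p'.inp ∧ MCmd.Le c p'.cmd ∧ o ≤ p'.out

def MCmd.Le : MCmd S → MCmd S → Prop
  | .nothing, c' => c' = .nothing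
  | .pause, c' => c' = .pause
  | .exit n, c' => c' = .exit n
  | .emit s, c' => c' = .emit s
  | .awaitImm s, c' => c' = .awaitImm s
  | .trap p, c' => ∃ p', c' = .trap p' ∧ MState.Le p p'
  | .shift p, c' => ∃ p', c' = .shift p' ∧ MState.Le p p'
  | .suspend s p, c' => ∃ p', c' = .suspend s p' ∧ MState.Le p p'
  | .ite s p q, c' => ∃ p' q', c' = .ite s p' q' ∧ MState.Le p p' ∧ MState.Le q q'
  | .seq p q, c' => ∃ p' q', c' = .seq p' q' ∧ MState.Le p p' ∧ MState.Le q q'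
  | .par p q, c' => ∃ p' q', c' = .par p' q' ∧ MState.Le p p' ∧ MState.Le q q'
  | .signal s p, c' => ∃ p', c' = .signal s p' ∧ MState.Le p p'
end

instance : LE (MState S) := ⟨MState.Le⟩

instance : LT (MState S) := ⟨fun p q => p ≤ q ∧ ¬ q ≤ p⟩

/-- No wire of the input color is undefined. -/
def InColor.Total (i : InColor) : Prop := i.go ≠ .bot ∧ i.res ≠ .bot ∧ i.susp ≠ .bot

/-- The output color is `white ∅` or some `black k`. -/
def OutColor.Total (o : OutColor) : Prop := o = .white ∅ ∨ ∃ k, o = .black k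

mutual
/-- A microstate is total if all its colors, at every depth, are total. -/
def MState.Total : MState S → Prop
  | .colors _ i c o => i.Total ∧ c.Total ∧ o.Total

def MCmd.Total : MCmd S → Prop
  | .nothing => True
  | .pause => True
  | .exit _ => True
  | .emit _ => True
  | .awaitImm _ => True
  | .trap p => p.Total
  | .shift p => p.Total
  | .suspend _ p => p.Total
  | .ite _ p q => p.Total ∧ q.Total
  | .seq p q => p.Total ∧ q.Total
  | .par p q => p.Total ∧ q.Total
  | .signal _ p => p.Total
end

/-! ### Events -/

/-- Events: partial maps from signals to statuses, defined on the visible signals. -/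
abbrev Event (S : Type u) := S → Option SBool

/-- The status `E(s)`, which is `bot` if `s` is not visible. -/
def Event.status (E : Event S) (s : S) : SBool := (E s).getD .bot

variable [DecidableEq S]

/-- The event `s^b * E`: the signal `s` gets the status `b`, hiding any outer signal `s`. -/
def Event.add (E : Event S) (s : S) (b : SBool) : Event S := Function.update E s (some b)

mutual
/-- The output colors of all the emitters of `s` in a microstate. Emitters below a local
declaration of the same name `s` refer to that local signal and are not counted. -/
def MState.emitters (s : S) : MState S → List OutColor
  | .colors _ _ c o => c.emitters s o

def MCmd.emitters (s : S) : MCmd S → OutColor → List OutColor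
  | .nothing, _ => []
  | .pause, _ => []
  | .exit _, _ => []
  | .emit s', o => if s' = s then [o] else []
  | .awaitImm _, _ => []
  | .trap p, _ => p.emitters s
  | .shift p, _ => p.emitters s
  | .suspend _ p, _ => p.emitters s
  | .ite _ p q, _ => p.emitters s ++ q.emitters s
  | .seq p q, _ => p.emitters s ++ q.emitters s
  | .par p q, _ => p.emitters s ++ q.emitters s
  | .signal s' p, _ => if s' = s then [] else p.emitters s
end

/-- The status of `s` deduced from its emitters in `p`: present if one of them has emitted `s`,
absent if all of them are dead, unknown otherwise. -/
def MState.emitStatus (p : MState S) (s : S) : SBool :=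
  if .black 0 ∈ p.emitters s then .pos
  else if ∀ o ∈ p.emitters s, o = .white ∅ then .neg
  else .bot

/-- The output event of a microstate, on the signals that are visible in `E`. -/
def MState.toEvent (p : MState S) (E : Event S) : Event S :=
  fun s => (E s).map fun _ => p.emitStatus s

/-! ### The microstep semantics -/

/-- Starting an inert statement. -/
def IsGo (sel : Bool) (i : InColor) : Prop := sel = false ∧ i.go = .pos

/-- Leaving dead an inert statement. -/
def IsNoGo (sel : Bool) (i : InColor) : Prop := sel = false ∧ i.go = .neg

/-- Resuming an active statement. -/
def IsRes (sel : Bool) (i : InColor) : Prop := sel = true ∧ i.res = .pos ∧ i.susp = .neg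

/-- The statement is executed, either started or resumed. -/
def IsGoRes (sel : Bool) (i : InColor) : Prop :=
  i.go = .pos ∨ (sel = true ∧ i.res = .pos)

/-- The statement is not executed. -/
def IsNoGoRes (sel : Bool) (i : InColor) : Prop :=
  i.go = .neg ∧ (sel = false ∨ i.res = .neg)

/-- The Res wire of the body `p` of a suspension on `s` with input color `i`. -/
def suspRes (E : Event S) (i : InColor) (s : S) (p : MState S) : SBool :=
  (i.res.and (.ofBool p.sel)).and (E.status s).not

/-- The Susp wire of the body `p` of a suspension on `s` with input color `i`. -/
def suspSusp (E : Event S) (i : InColor) (s : S) (p : MState S) : SBool :=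
  i.susp.or ((i.res.and (.ofBool p.sel)).and (E.status s))

open MState in
/-- The microstep relation in the event `E`, for a given synchronizer. -/
inductive Step (sync : Synchronizer) : Event S → MState S → MState S → Prop
  -- nothing
  | nothing_nogo {E : Event S} {b i} : IsNoGo b i →
      Step sync E (colors b i .nothing (.white {0})) (colors b i .nothing (.white ∅))
  | nothing_go {E : Event S} {b i} : IsGo b i →
      Step sync E (colors b i .nothing (.white {0})) (colors b i .nothing (.black 0))
  -- exit
  | exit_nogo {E : Event S} {b i n} : IsNoGo b i →
      Step sync E (colors b i (.exit n) (.white {n + 2})) (colors b i (.exit n) (.white ∅))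
  | exit_go {E : Event S} {b i n} : IsGo b i →
      Step sync E (colors b i (.exit n) (.white {n + 2})) (colors b i (.exit n) (.black (n + 2)))
  -- emit
  | emit_nogo {E : Event S} {b i s} : IsNoGo b i →
      Step sync E (colors b i (.emit s) (.white {0})) (colors b i (.emit s) (.white ∅))
  | emit_go {E : Event S} {b i s} : IsGo b i →
      Step sync E (colors b i (.emit s) (.white {0})) (colors b i (.emit s) (.black 0))
  -- pause
  | pause_not0 {E : Event S} {b i K} : (i.res = .neg ∨ b = false) → 0 ∈ K →
      Step sync E (colors b i .pause (.white K)) (colors b i .pause (.white (K.erase 0)))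
  | pause_not1 {E : Event S} {b i K} : i.go = .neg → 1 ∈ K →
      Step sync E (colors b i .pause (.white K)) (colors b i .pause (.white (K.erase 1)))
  | pause_1 {E : Event S} {b i o} : i.go = .pos → o < .black 1 →
      Step sync E (colors b i .pause o) (colors b i .pause (.black 1))
  | pause_0 {E : Event S} {b i o} : IsRes b i → o < .black 0 →
      Step sync E (colors b i .pause o) (colors b i .pause (.black 0))
  -- await immediate
  | await_not0 {E : Event S} {b i s K} : (IsNoGoRes b i ∨ E s = some .neg) → 0 ∈ K →
      Step sync E (colors b i (.awaitImm s) (.white K))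
        (colors b i (.awaitImm s) (.white (K.erase 0)))
  | await_not1 {E : Event S} {b i s K} : (IsNoGoRes b i ∨ E s = some .pos) → 1 ∈ K →
      Step sync E (colors b i (.awaitImm s) (.white K))
        (colors b i (.awaitImm s) (.white (K.erase 1)))
  | await_1 {E : Event S} {b i s o} : IsGoRes b i → E s = some .neg → o < .black 1 →
      Step sync E (colors b i (.awaitImm s) o) (colors b i (.awaitImm s) (.black 1))
  | await_0 {E : Event S} {b i s o} : IsGoRes b i → E s = some .pos → o < .black 0 →
      Step sync E (colors b i (.awaitImm s) o) (colors b i (.awaitImm s) (.black 0))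
  -- trap
  | trap_start {E : Event S} {b i p o} : p.inp < i →
      Step sync E (colors b i (.trap p) o) (colors b i (.trap (p.setIn i)) o)
  | trap_ctx {E : Event S} {b i p p' o} : Step sync E p p' →
      Step sync E (colors b i (.trap p) o) (colors b i (.trap p') o)
  | trap_end {E : Event S} {b i p o} : o < p.out.map codeDown →
      Step sync E (colors b i (.trap p) o) (colors b i (.trap p) (p.out.map codeDown))
  -- shift
  | shift_start {E : Event S} {b i p o} : p.inp < i →
      Step sync E (colors b i (.shift p) o) (colors b i (.shift (p.setIn i)) o)
  | shift_ctx {E : Event S} {b i p p' o} : Step sync E p p' →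
      Step sync E (colors b i (.shift p) o) (colors b i (.shift p') o)
  | shift_end {E : Event S} {b i p o} : o < p.out.map codeUp →
      Step sync E (colors b i (.shift p) o) (colors b i (.shift p) (p.out.map codeUp))
  -- suspend
  | suspend_go {E : Event S} {b i s p o} : p.inp.go < i.go →
      Step sync E (colors b i (.suspend s p) o) (colors b i (.suspend s (p.setGo i.go)) o)
  | suspend_res {E : Event S} {b i s p o} : p.inp.res < suspRes E i s p →
      Step sync E (colors b i (.suspend s p) o)
        (colors b i (.suspend s (p.setRes (suspRes E i s p))) o)
  | suspend_susp {E : Event S} {b i s p o} : p.inp.susp < suspSusp E i s p →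
      Step sync E (colors b i (.suspend s p) o)
        (colors b i (.suspend s (p.setSusp (suspSusp E i s p))) o)
  | suspend_ctx {E : Event S} {b i s p p' o} : Step sync E p p' →
      Step sync E (colors b i (.suspend s p) o) (colors b i (.suspend s p') o)
  | suspend_end_bot {E : Event S} {b i s p o} : o < suspNow .bot p.out →
      Step sync E (colors b i (.suspend s p) o) (colors b i (.suspend s p) (suspNow .bot p.out))
  | suspend_end {E : Event S} {b i s p o} : o < suspNow (suspSusp E i s p) p.out →
      Step sync E (colors b i (.suspend s p) o)
        (colors b i (.suspend s p) (suspNow (suspSusp E i s p) p.out))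
  -- presence test
  | ite_go_left {E : Event S} {b i s p q o} : p.inp.go < i.go.and (E.status s) →
      Step sync E (colors b i (.ite s p q) o)
        (colors b i (.ite s (p.setGo (i.go.and (E.status s))) q) o)
  | ite_go_right {E : Event S} {b i s p q o} : q.inp.go < i.go.and (E.status s).not →
      Step sync E (colors b i (.ite s p q) o)
        (colors b i (.ite s p (q.setGo (i.go.and (E.status s).not))) o)
  | ite_res_left {E : Event S} {b i s p q o} : p.inp.res < i.res →
      Step sync E (colors b i (.ite s p q) o) (colors b i (.ite s (p.setRes i.res) q) o)
  | ite_res_right {E : Event S} {b i s p q o} : q.inp.res < i.res →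
      Step sync E (colors b i (.ite s p q) o) (colors b i (.ite s p (q.setRes i.res)) o)
  | ite_susp_left {E : Event S} {b i s p q o} : p.inp.susp < i.susp →
      Step sync E (colors b i (.ite s p q) o) (colors b i (.ite s (p.setSusp i.susp) q) o)
  | ite_susp_right {E : Event S} {b i s p q o} : q.inp.susp < i.susp →
      Step sync E (colors b i (.ite s p q) o) (colors b i (.ite s p (q.setSusp i.susp)) o)
  | ite_ctx_left {E : Event S} {b i s p p' q o} : Step sync E p p' →
      Step sync E (colors b i (.ite s p q) o) (colors b i (.ite s p' q) o)
  | ite_ctx_right {E : Event S} {b i s p q q' o} : Step sync E q q' →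
      Step sync E (colors b i (.ite s p q) o) (colors b i (.ite s p q') o)
  | ite_end {E : Event S} {b i s p q o} : o < p.out.union q.out →
      Step sync E (colors b i (.ite s p q) o) (colors b i (.ite s p q) (p.out.union q.out))
  -- sequence
  | seq_start {E : Event S} {b i p q o} : p.inp < i →
      Step sync E (colors b i (.seq p q) o) (colors b i (.seq (p.setIn i) q) o)
  | seq_res {E : Event S} {b i p q o} : q.inp.res < i.res →
      Step sync E (colors b i (.seq p q) o) (colors b i (.seq p (q.setRes i.res)) o)
  | seq_susp {E : Event S} {b i p q o} : q.inp.susp < i.susp →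
      Step sync E (colors b i (.seq p q) o) (colors b i (.seq p (q.setSusp i.susp)) o)
  | seq_go {E : Event S} {b i p q o} : p.out = .black 0 → q.inp.go = .bot →
      Step sync E (colors b i (.seq p q) o) (colors b i (.seq p (q.setGo .pos)) o)
  | seq_nogo {E : Event S} {b i p q o} : ¬ p.out ≤ .black 0 → q.inp.go = .bot →
      Step sync E (colors b i (.seq p q) o) (colors b i (.seq p (q.setGo .neg)) o)
  | seq_ctx_left {E : Event S} {b i p p' q o} : Step sync E p p' →
      Step sync E (colors b i (.seq p q) o) (colors b i (.seq p' q) o)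
  | seq_ctx_right {E : Event S} {b i p q q' o} : Step sync E q q' →
      Step sync E (colors b i (.seq p q) o) (colors b i (.seq p q') o)
  | seq_end {E : Event S} {b i p q o} : o < p.out.eraseZero.union q.out →
      Step sync E (colors b i (.seq p q) o) (colors b i (.seq p q) (p.out.eraseZero.union q.out))
  -- parallel
  | par_start_left {E : Event S} {b i p q o} : p.inp < i →
      Step sync E (colors b i (.par p q) o) (colors b i (.par (p.setIn i) q) o)
  | par_start_right {E : Event S} {b i p q o} : q.inp < i →
      Step sync E (colors b i (.par p q) o) (colors b i (.par p (q.setIn i)) o)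
  | par_ctx_left {E : Event S} {b i p p' q o} : Step sync E p p' →
      Step sync E (colors b i (.par p q) o) (colors b i (.par p' q) o)
  | par_ctx_right {E : Event S} {b i p q q' o} : Step sync E q q' →
      Step sync E (colors b i (.par p q) o) (colors b i (.par p q') o)
  | par_end {E : Event S} {b i p q o} : o < sync p.sel q.sel p.out q.out →
      Step sync E (colors b i (.par p q) o)
        (colors b i (.par p q) (sync p.sel q.sel p.out q.out))
  -- local signal
  | signal_start {E : Event S} {b i s p o} : p.inp < i →
      Step sync E (colors b i (.signal s p) o) (colors b i (.signal s (p.setIn i)) o)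
  | signal_ctx {E : Event S} {b i s p p' o} :
      Step sync (E.add s ((p.toEvent (E.add s .bot)).status s)) p p' →
      Step sync E (colors b i (.signal s p) o) (colors b i (.signal s p') o)
  | signal_end {E : Event S} {b i s p o} : o < p.out →
      Step sync E (colors b i (.signal s p) o) (colors b i (.signal s p) p.out)

/-- A finite (possibly empty) sequence of microsteps. -/
def Steps (sync : Synchronizer) (E : Event S) : MState S → MState S → Prop :=
  Relation.ReflTransGen (Step sync E)

end Microstates

end Esterel

/-!
A microstep changes a single color of a microstate, either an output color or wires of an input
color, and each rule replaces that color by a strictly larger one. Hence `p < p'` by induction on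
the derivation (`Step.lt`), and the preservation of the base statement and of the Sel values is
part of the order. Total colors are maximal, so that nothing lies strictly above a total microstate
(`MState.Total.not_lt`).

For the compatibility with input colors, the point is that the value written by a rule is a
monotone function of the input color `i` of the whole statement, while the side conditions are
preserved when `i` grows. If `i ≤ j`, the rule therefore still applies after the input color has
been raised to `j`, and writes a possibly larger value. Raising the input color after the microstep
instead leaves the smaller value in place, and the same rule brings it up to date in at most one
microstep (`Step.exists_setIn`). The only gate which needs a computation is the return code
`suspNow` of a suspension, monotone in the status of the suspension (`suspNow_mono`). The
comparison of `p'` with the common reduct is then a consequence of `Step.lt`.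
-/

namespace Esterel

universe v

/-! ### Monotonicity of the gates -/

namespace SBool

theorem le_def {a b : SBool} : a ≤ b ↔ a = bot ∨ a = b := Iff.rfl

theorem bot_lt_of_ne {b : SBool} (h : b ≠ bot) : bot < b :=
  lt_of_le_of_ne (Or.inl rfl) h.symm

theorem eq_of_le {a b : SBool} (h : a ≤ b) (ha : a ≠ bot) : b = a :=
  (h.resolve_left ha).symm

theorem and_mono {a a' b b' : SBool} (h : a ≤ a') (h' : b ≤ b') : a.and b ≤ a'.and b' := by
  rw [le_def] at *
  cases a <;> cases a' <;> cases b <;> cases b' <;> simp_all [SBool.and]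

theorem or_mono {a a' b b' : SBool} (h : a ≤ a') (h' : b ≤ b') : a.or b ≤ a'.or b' := by
  rw [le_def] at *
  cases a <;> cases a' <;> cases b <;> cases b' <;> simp_all [SBool.or]

end SBool

theorem InColor.le_def {i j : InColor} :
    i ≤ j ↔ i.go ≤ j.go ∧ i.res ≤ j.res ∧ i.susp ≤ j.susp := Iff.rfl

theorem InColor.le_of_total {i j : InColor} (hi : i.Total) (h : i ≤ j) : j ≤ i := by
  obtain ⟨h₁, h₂, h₃⟩ := InColor.le_def.1 h
  exact InColor.le_def.2 ⟨(SBool.eq_of_le h₁ hi.1).le, (SBool.eq_of_le h₂ hi.2.1).le,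
    (SBool.eq_of_le h₃ hi.2.2).le⟩

namespace OutColor

@[simp] theorem white_le_white {K L : Finset ℕ} : white K ≤ white L ↔ L ⊆ K := Iff.rfl

@[simp] theorem white_le_black {K : Finset ℕ} {k : ℕ} : white K ≤ black k ↔ k ∈ K := Iff.rfl

@[simp] theorem black_le_black {k l : ℕ} : black k ≤ black l ↔ k = l := Iff.rfl

@[simp] theorem not_black_le_white {k : ℕ} {K : Finset ℕ} : ¬ black k ≤ white K := id

theorem white_lt_black {K : Finset ℕ} {k : ℕ} (h : k ∈ K) : white K < black k :=
  lt_of_le_not_ge h not_black_le_white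

theorem white_lt_erase {K : Finset ℕ} {k : ℕ} (h : k ∈ K) : white K < white (K.erase k) :=
  lt_of_le_not_ge (white_le_white.2 (K.erase_subset k))
    fun h' => Finset.notMem_erase k K (white_le_white.1 h' h)

theorem white_singleton_lt_empty {k : ℕ} : white {k} < white ∅ := by
  simpa using white_lt_erase (Finset.mem_singleton_self k)

theorem le_of_total {o o' : OutColor} (ho : o.Total) (h : o ≤ o') : o' ≤ o := by
  rcases ho with rfl | ⟨k, rfl⟩ <;> cases o' <;> simp_all

end OutColor

theorem suspNow_mono {a b : SBool} (h : a ≤ b) (o : OutColor) : suspNow a o ≤ suspNow b o := by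
  rcases h with rfl | rfl
  · cases b with
    | bot => exact le_rfl
    | neg =>
      rcases o with (_ | k) | K <;> simp [suspNow, OutColor.union]
    | pos =>
      rcases o with (_ | k) | K
      · simp [suspNow]
      · simp [suspNow, OutColor.union]
      · by_cases hK : K = ∅
        · simp [suspNow, OutColor.union, hK]
        · simp only [suspNow, OutColor.union, hK, reduceCtorEq, if_false,
            OutColor.white_le_white, ← Finset.insert_eq]
          exact Finset.insert_subset_insert _ (K.erase_subset 0)
  · exact le_rfl

section

variable {S : Type v}

theorem suspRes_mono (E : Event S) {i j : InColor} (hij : i ≤ j) (s : S) (p : MState S) :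
    suspRes E i s p ≤ suspRes E j s p :=
  SBool.and_mono (SBool.and_mono (InColor.le_def.1 hij).2.1 le_rfl) le_rfl

theorem suspSusp_mono (E : Event S) {i j : InColor} (hij : i ≤ j) (s : S) (p : MState S) :
    suspSusp E i s p ≤ suspSusp E j s p :=
  SBool.or_mono (InColor.le_def.1 hij).2.2
    (SBool.and_mono (SBool.and_mono (InColor.le_def.1 hij).2.1 le_rfl) le_rfl)

/-! ### The order on microstates -/

namespace MState

@[simp] theorem colors_le_colors {b b' : Bool} {i i' : InColor} {c c' : MCmd S}
    {o o' : OutColor} :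
    colors b i c o ≤ colors b' i' c' o' ↔ b = b' ∧ i ≤ i' ∧ c.Le c' ∧ o ≤ o' := by
  change MState.Le _ _ ↔ _
  simp [MState.Le, MState.sel, MState.inp, MState.cmd, MState.out]

end MState

/-- Unfolding `MCmd.Le` exposes `MState.Le` for the sub-microstates; this folds it back into `≤`. -/
theorem MState.Le_iff {p q : MState S} : p.Le q ↔ p ≤ q := Iff.rfl

mutual

theorem MState.le_refl' : ∀ p : MState S, p ≤ p
  | .colors _ _ c _ => MState.colors_le_colors.2 ⟨rfl, le_rfl, MCmd.le_refl' c, le_rfl⟩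

theorem MCmd.le_refl' : ∀ c : MCmd S, c.Le c
  | .nothing | .pause | .exit _ | .emit _ | .awaitImm _ => by simp [MCmd.Le]
  | .trap p | .shift p | .suspend _ p | .signal _ p => by
    simpa [MCmd.Le, MState.Le_iff] using MState.le_refl' p
  | .ite _ p q | .seq p q | .par p q => by
    simpa [MCmd.Le, MState.Le_iff] using And.intro (MState.le_refl' p) (MState.le_refl' q)

end

mutual

theorem MState.le_trans' : ∀ {p q r : MState S}, p ≤ q → q ≤ r → p ≤ r
  | .colors _ _ _ _, .colors _ _ _ _, .colors _ _ _ _, h, h' => by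
    rw [MState.colors_le_colors] at h h' ⊢
    exact ⟨h.1.trans h'.1, h.2.1.trans h'.2.1, MCmd.le_trans' h.2.2.1 h'.2.2.1,
      h.2.2.2.trans h'.2.2.2⟩

theorem MCmd.le_trans' : ∀ {c d e : MCmd S}, c.Le d → d.Le e → c.Le e
  | .nothing, _, _, h, h' | .pause, _, _, h, h' | .exit _, _, _, h, h'
  | .emit _, _, _, h, h' | .awaitImm _, _, _, h, h' => by
    simp only [MCmd.Le] at h
    subst h
    exact h'
  | .trap p, _, _, h, h' | .shift p, _, _, h, h' | .suspend _ p, _, _, h, h'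
  | .signal _ p, _, _, h, h' => by
    simp only [MCmd.Le] at h
    obtain ⟨q, rfl, hq⟩ := h
    simp only [MCmd.Le] at h'
    obtain ⟨r, rfl, hr⟩ := h'
    simp only [MCmd.Le]
    exact ⟨r, rfl, MState.le_trans' (p := p) hq hr⟩
  | .ite _ p₁ p₂, _, _, h, h' | .seq p₁ p₂, _, _, h, h' | .par p₁ p₂, _, _, h, h' => by
    simp only [MCmd.Le] at h
    obtain ⟨q₁, q₂, rfl, hq₁, hq₂⟩ := h
    simp only [MCmd.Le] at h'
    obtain ⟨r₁, r₂, rfl, hr₁, hr₂⟩ := h'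
    simp only [MCmd.Le]
    exact ⟨r₁, r₂, rfl, MState.le_trans' (p := p₁) hq₁ hr₁, MState.le_trans' (p := p₂) hq₂ hr₂⟩

end

/-- The information order on microstates, with the `≤` and the `<` defined above as instances. -/
instance : Preorder (MState S) where
  le_refl := MState.le_refl'
  le_trans _ _ _ := MState.le_trans'
  lt_iff_le_not_ge _ _ := Iff.rfl

mutual

theorem MState.base_sels_eq_of_le :
    ∀ {p q : MState S}, p ≤ q → p.base = q.base ∧ p.sels = q.sels
  | .colors _ _ _ _, .colors _ _ _ _, h => by
    rw [MState.colors_le_colors] at h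
    have := MCmd.base_sels_eq_of_le h.2.2.1
    simp [MState.base, MState.sels, h.1, this]

theorem MCmd.base_sels_eq_of_le :
    ∀ {c d : MCmd S}, c.Le d → c.base = d.base ∧ c.sels = d.sels
  | .nothing, _, h | .pause, _, h | .exit _, _, h | .emit _, _, h | .awaitImm _, _, h => by
    simp only [MCmd.Le] at h
    simp [h]
  | .trap p, _, h | .shift p, _, h | .suspend _ p, _, h | .signal _ p, _, h => by
    simp only [MCmd.Le] at h
    obtain ⟨q, rfl, hq⟩ := h
    simp [MCmd.base, MCmd.sels, MState.base_sels_eq_of_le (p := p) hq]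
  | .ite _ p₁ p₂, _, h | .seq p₁ p₂, _, h | .par p₁ p₂, _, h => by
    simp only [MCmd.Le] at h
    obtain ⟨q₁, q₂, rfl, h₁, h₂⟩ := h
    simp [MCmd.base, MCmd.sels, MState.base_sels_eq_of_le (p := p₁) h₁,
      MState.base_sels_eq_of_le (p := p₂) h₂]

end

mutual

theorem MState.Total.le_of_le : ∀ {p q : MState S}, p.Total → p ≤ q → q ≤ p
  | .colors _ _ _ _, .colors _ _ _ _, ht, h => by
    rw [MState.colors_le_colors] at h ⊢
    simp only [MState.Total] at ht
    exact ⟨h.1.symm, InColor.le_of_total ht.1 h.2.1, MCmd.Total.le_of_le ht.2.1 h.2.2.1,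
      OutColor.le_of_total ht.2.2 h.2.2.2⟩

theorem MCmd.Total.le_of_le : ∀ {c d : MCmd S}, c.Total → c.Le d → d.Le c
  | .nothing, _, _, h | .pause, _, _, h | .exit _, _, _, h | .emit _, _, _, h
  | .awaitImm _, _, _, h => by
    simp only [MCmd.Le] at h
    subst h
    exact MCmd.le_refl' _
  | .trap p, _, ht, h | .shift p, _, ht, h | .suspend _ p, _, ht, h
  | .signal _ p, _, ht, h => by
    simp only [MCmd.Le] at h
    obtain ⟨q, rfl, hq⟩ := h
    simp only [MCmd.Total] at ht
    simpa [MCmd.Le, MState.Le_iff] using MState.Total.le_of_le (p := p) ht hq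
  | .ite _ p₁ p₂, _, ht, h | .seq p₁ p₂, _, ht, h | .par p₁ p₂, _, ht, h => by
    simp only [MCmd.Le] at h
    obtain ⟨q₁, q₂, rfl, h₁, h₂⟩ := h
    simp only [MCmd.Total] at ht
    simpa [MCmd.Le, MState.Le_iff] using And.intro (MState.Total.le_of_le (p := p₁) ht.1 h₁)
      (MState.Total.le_of_le (p := p₂) ht.2 h₂)

end

namespace MState

/-- Total microstates are maximal. -/
theorem Total.not_lt {p q : MState S} (hp : p.Total) : ¬ p < q :=
  fun h => h.not_ge (hp.le_of_le h.le)

@[simp] theorem setIn_colors (b : Bool) (i j : InColor) (c : MCmd S) (o : OutColor) :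
    (colors b i c o).setIn j = colors b j c o := rfl

@[simp] theorem inp_setIn (p : MState S) (i : InColor) : (p.setIn i).inp = i := by cases p; rfl

@[simp] theorem sel_setIn (p : MState S) (i : InColor) : (p.setIn i).sel = p.sel := by
  cases p; rfl

@[simp] theorem out_setIn (p : MState S) (i : InColor) : (p.setIn i).out = p.out := by
  cases p; rfl

@[simp] theorem setIn_setIn (p : MState S) (i j : InColor) :
    (p.setIn i).setIn j = p.setIn j := by cases p; rfl

@[simp] theorem setGo_setGo (p : MState S) (a b : SBool) : (p.setGo a).setGo b = p.setGo b := by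
  simp [setGo]

@[simp] theorem setRes_setRes (p : MState S) (a b : SBool) :
    (p.setRes a).setRes b = p.setRes b := by
  simp [setRes]

@[simp] theorem setSusp_setSusp (p : MState S) (a b : SBool) :
    (p.setSusp a).setSusp b = p.setSusp b := by
  simp [setSusp]

@[simp] theorem sel_setRes (p : MState S) (a : SBool) : (p.setRes a).sel = p.sel := sel_setIn _ _

@[simp] theorem sel_setSusp (p : MState S) (a : SBool) : (p.setSusp a).sel = p.sel :=
  sel_setIn _ _

@[simp] theorem go_setGo (p : MState S) (a : SBool) : (p.setGo a).inp.go = a := by simp [setGo]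

@[simp] theorem res_setRes (p : MState S) (a : SBool) : (p.setRes a).inp.res = a := by
  simp [setRes]

@[simp] theorem susp_setSusp (p : MState S) (a : SBool) : (p.setSusp a).inp.susp = a := by
  simp [setSusp]

theorem le_setIn {p : MState S} {i : InColor} (h : p.inp ≤ i) : p ≤ p.setIn i := by
  cases p
  exact colors_le_colors.2 ⟨rfl, h, MCmd.le_refl' _, le_rfl⟩

theorem inp_mono {p q : MState S} (h : p ≤ q) : p.inp ≤ q.inp := by
  cases p; cases q
  exact (colors_le_colors.1 h).2.1

theorem lt_setIn {p : MState S} {i : InColor} (h : p.inp < i) : p < p.setIn i :=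
  lt_of_le_not_ge (le_setIn h.le) fun h' => h.not_ge (by simpa using inp_mono h')

theorem lt_setGo {p : MState S} {a : SBool} (h : p.inp.go < a) : p < p.setGo a :=
  lt_setIn (lt_of_le_not_ge (InColor.le_def.2 ⟨h.le, le_rfl, le_rfl⟩)
    fun h' => h.not_ge (InColor.le_def.1 h').1)

theorem lt_setRes {p : MState S} {a : SBool} (h : p.inp.res < a) : p < p.setRes a :=
  lt_setIn (lt_of_le_not_ge (InColor.le_def.2 ⟨le_rfl, h.le, le_rfl⟩)
    fun h' => h.not_ge (InColor.le_def.1 h').2.1)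

theorem lt_setSusp {p : MState S} {a : SBool} (h : p.inp.susp < a) : p < p.setSusp a :=
  lt_setIn (lt_of_le_not_ge (InColor.le_def.2 ⟨le_rfl, le_rfl, h.le⟩)
    fun h' => h.not_ge (InColor.le_def.1 h').2.2)

theorem colors_lt_of_out {b : Bool} {i : InColor} {c : MCmd S} {o o' : OutColor} (h : o < o') :
    colors b i c o < colors b i c o' :=
  lt_of_le_not_ge (colors_le_colors.2 ⟨rfl, le_rfl, MCmd.le_refl' _, h.le⟩)
    fun h' => h.not_ge (colors_le_colors.1 h').2.2.2

theorem colors_lt_of_cmd {b : Bool} {i : InColor} {c c' : MCmd S} {o : OutColor}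
    (h : c.Le c') (h' : ¬ c'.Le c) : colors b i c o < colors b i c' o :=
  lt_of_le_not_ge (colors_le_colors.2 ⟨rfl, le_rfl, h, le_rfl⟩)
    fun h'' => h' (colors_le_colors.1 h'').2.2.1

section Contexts

variable {b : Bool} {i : InColor} {o : OutColor} {s : S} {p p' : MState S}

theorem trap_lt (h : p < p') : colors b i (.trap p) o < colors b i (.trap p') o := by
  apply colors_lt_of_cmd <;> simp [MCmd.Le, Le_iff, h.le, h.not_ge]

theorem shift_lt (h : p < p') : colors b i (.shift p) o < colors b i (.shift p') o := by
  apply colors_lt_of_cmd <;> simp [MCmd.Le, Le_iff, h.le, h.not_ge]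

theorem suspend_lt (h : p < p') :
    colors b i (.suspend s p) o < colors b i (.suspend s p') o := by
  apply colors_lt_of_cmd <;> simp [MCmd.Le, Le_iff, h.le, h.not_ge]

theorem signal_lt (h : p < p') :
    colors b i (.signal s p) o < colors b i (.signal s p') o := by
  apply colors_lt_of_cmd <;> simp [MCmd.Le, Le_iff, h.le, h.not_ge]

theorem ite_lt_left (h : p < p') (q : MState S) :
    colors b i (.ite s p q) o < colors b i (.ite s p' q) o := by
  apply colors_lt_of_cmd <;> simp [MCmd.Le, Le_iff, h.le, h.not_ge]

theorem ite_lt_right (h : p < p') (q : MState S) :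
    colors b i (.ite s q p) o < colors b i (.ite s q p') o := by
  apply colors_lt_of_cmd <;> simp [MCmd.Le, Le_iff, h.le, h.not_ge]

theorem seq_lt_left (h : p < p') (q : MState S) :
    colors b i (.seq p q) o < colors b i (.seq p' q) o := by
  apply colors_lt_of_cmd <;> simp [MCmd.Le, Le_iff, h.le, h.not_ge]

theorem seq_lt_right (h : p < p') (q : MState S) :
    colors b i (.seq q p) o < colors b i (.seq q p') o := by
  apply colors_lt_of_cmd <;> simp [MCmd.Le, Le_iff, h.le, h.not_ge]

theorem par_lt_left (h : p < p') (q : MState S) :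
    colors b i (.par p q) o < colors b i (.par p' q) o := by
  apply colors_lt_of_cmd <;> simp [MCmd.Le, Le_iff, h.le, h.not_ge]

theorem par_lt_right (h : p < p') (q : MState S) :
    colors b i (.par q p) o < colors b i (.par q p') o := by
  apply colors_lt_of_cmd <;> simp [MCmd.Le, Le_iff, h.le, h.not_ge]

end Contexts

end MState

/-! ### Microsteps increase information -/

variable [DecidableEq S] {sync : Synchronizer} {E : Event S}

open MState OutColor

theorem Step.lt {p p' : MState S} (h : Step sync E p p') : p < p' := by
  induction h with
  | nothing_nogo | exit_nogo | emit_nogo => exact colors_lt_of_out white_singleton_lt_empty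
  | nothing_go | exit_go | emit_go =>
    exact colors_lt_of_out (white_lt_black (Finset.mem_singleton_self _))
  | pause_not0 _ h | pause_not1 _ h | await_not0 _ h | await_not1 _ h =>
    exact colors_lt_of_out (white_lt_erase h)
  | pause_1 _ h | pause_0 _ h | await_1 _ _ h | await_0 _ _ h => exact colors_lt_of_out h
  | trap_end h | shift_end h | suspend_end_bot h | suspend_end h | ite_end h | seq_end h
  | par_end h | signal_end h => exact colors_lt_of_out h
  | trap_start h => exact trap_lt (lt_setIn h)
  | trap_ctx _ ih => exact trap_lt ih
  | shift_start h => exact shift_lt (lt_setIn h)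
  | shift_ctx _ ih => exact shift_lt ih
  | suspend_go h => exact suspend_lt (lt_setGo h)
  | suspend_res h => exact suspend_lt (lt_setRes h)
  | suspend_susp h => exact suspend_lt (lt_setSusp h)
  | suspend_ctx _ ih => exact suspend_lt ih
  | ite_go_left h => exact ite_lt_left (lt_setGo h) _
  | ite_go_right h => exact ite_lt_right (lt_setGo h) _
  | ite_res_left h => exact ite_lt_left (lt_setRes h) _
  | ite_res_right h => exact ite_lt_right (lt_setRes h) _
  | ite_susp_left h => exact ite_lt_left (lt_setSusp h) _
  | ite_susp_right h => exact ite_lt_right (lt_setSusp h) _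
  | ite_ctx_left _ ih => exact ite_lt_left ih _
  | ite_ctx_right _ ih => exact ite_lt_right ih _
  | seq_start h => exact seq_lt_left (lt_setIn h) _
  | seq_res h => exact seq_lt_right (lt_setRes h) _
  | seq_susp h => exact seq_lt_right (lt_setSusp h) _
  | seq_go _ h | seq_nogo _ h =>
    exact seq_lt_right (lt_setGo (h ▸ SBool.bot_lt_of_ne (by decide))) _
  | seq_ctx_left _ ih => exact seq_lt_left ih _
  | seq_ctx_right _ ih => exact seq_lt_right ih _
  | par_start_left h => exact par_lt_left (lt_setIn h) _
  | par_start_right h => exact par_lt_right (lt_setIn h) _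
  | par_ctx_left _ ih => exact par_lt_left ih _
  | par_ctx_right _ ih => exact par_lt_right ih _
  | signal_start h => exact signal_lt (lt_setIn h)
  | signal_ctx _ ih => exact signal_lt ih

theorem Step.inp_eq {p p' : MState S} (h : Step sync E p p') : p.inp = p'.inp := by
  cases h <;> rfl

theorem Step.cmd_eq_or_out_eq {p p' : MState S} (h : Step sync E p p') :
    p.cmd = p'.cmd ∨ p.out = p'.out := by
  cases h <;> first | exact Or.inl rfl | exact Or.inr rfl

theorem Steps.le {p p' : MState S} (h : Steps sync E p p') : p ≤ p' := by
  induction h with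
  | refl => exact le_rfl
  | tail _ h ih => exact ih.trans h.lt.le

/-! ### Raising the input color -/

theorem IsGo.mono {b : Bool} {i j : InColor} (hij : i ≤ j) (h : IsGo b i) : IsGo b j :=
  ⟨h.1, h.2 ▸ SBool.eq_of_le hij.1 (by simp [h.2])⟩

theorem IsNoGo.mono {b : Bool} {i j : InColor} (hij : i ≤ j) (h : IsNoGo b i) : IsNoGo b j :=
  ⟨h.1, h.2 ▸ SBool.eq_of_le hij.1 (by simp [h.2])⟩

theorem InColor.go_eq_of_le {i j : InColor} {a : SBool} (hij : i ≤ j) (h : i.go = a)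
    (ha : a ≠ .bot) : j.go = a :=
  h ▸ SBool.eq_of_le (InColor.le_def.1 hij).1 (h ▸ ha)

theorem InColor.res_eq_of_le {i j : InColor} {a : SBool} (hij : i ≤ j) (h : i.res = a)
    (ha : a ≠ .bot) : j.res = a :=
  h ▸ SBool.eq_of_le (InColor.le_def.1 hij).2.1 (h ▸ ha)

theorem InColor.susp_eq_of_le {i j : InColor} {a : SBool} (hij : i ≤ j) (h : i.susp = a)
    (ha : a ≠ .bot) : j.susp = a :=
  h ▸ SBool.eq_of_le (InColor.le_def.1 hij).2.2 (h ▸ ha)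

theorem IsRes.mono {b : Bool} {i j : InColor} (hij : i ≤ j) (h : IsRes b i) : IsRes b j :=
  ⟨h.1, InColor.res_eq_of_le hij h.2.1 (by decide), InColor.susp_eq_of_le hij h.2.2 (by decide)⟩

theorem IsGoRes.mono {b : Bool} {i j : InColor} (hij : i ≤ j) (h : IsGoRes b i) : IsGoRes b j :=
  h.imp (InColor.go_eq_of_le hij · (by decide))
    (And.imp_right (InColor.res_eq_of_le hij · (by decide)))

theorem IsNoGoRes.mono {b : Bool} {i j : InColor} (hij : i ≤ j) (h : IsNoGoRes b i) :
    IsNoGoRes b j :=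
  ⟨InColor.go_eq_of_le hij h.1 (by decide),
    h.2.imp_right (InColor.res_eq_of_le hij · (by decide))⟩

/-- A rule writes a color of type `α`, the rest of the microstate being given by `f`. If it can
write `y` over any smaller value, it brings `x ≤ y` up to date in at most one microstep. -/
theorem exists_step_of_le {α : Type*} [PartialOrder α] {p : MState S} (f : α → MState S) {x y : α}
    (hxy : x ≤ y) (hp : Step sync E p (f y)) (hstep : x < y → Step sync E (f x) (f y)) :
    ∃ p'', Step sync E p p'' ∧ Steps sync E (f x) p'' := by
  refine ⟨f y, hp, ?_⟩
  rcases hxy.eq_or_lt with rfl | h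
  · exact .refl
  · exact .single (hstep h)

theorem Step.exists_setIn {p p' : MState S} {j : InColor} (hj : p.inp ≤ j)
    (h : Step sync E p p') :
    ∃ p'', Step sync E (p.setIn j) p'' ∧ Steps sync E (p'.setIn j) p'' := by
  cases h with
  | nothing_nogo h => exact ⟨_, .nothing_nogo (h.mono hj), .refl⟩
  | nothing_go h => exact ⟨_, .nothing_go (h.mono hj), .refl⟩
  | exit_nogo h => exact ⟨_, .exit_nogo (h.mono hj), .refl⟩
  | exit_go h => exact ⟨_, .exit_go (h.mono hj), .refl⟩
  | emit_nogo h => exact ⟨_, .emit_nogo (h.mono hj), .refl⟩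
  | emit_go h => exact ⟨_, .emit_go (h.mono hj), .refl⟩
  | pause_not0 h hK =>
    exact ⟨_, .pause_not0 (h.imp_left (InColor.res_eq_of_le hj · (by decide))) hK, .refl⟩
  | pause_not1 h hK => exact ⟨_, .pause_not1 (InColor.go_eq_of_le hj h (by decide)) hK, .refl⟩
  | pause_1 h ho => exact ⟨_, .pause_1 (InColor.go_eq_of_le hj h (by decide)) ho, .refl⟩
  | pause_0 h ho => exact ⟨_, .pause_0 (h.mono hj) ho, .refl⟩
  | await_not0 h hK => exact ⟨_, .await_not0 (h.imp_left (·.mono hj)) hK, .refl⟩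
  | await_not1 h hK => exact ⟨_, .await_not1 (h.imp_left (·.mono hj)) hK, .refl⟩
  | await_1 h hE ho => exact ⟨_, .await_1 (h.mono hj) hE ho, .refl⟩
  | await_0 h hE ho => exact ⟨_, .await_0 (h.mono hj) hE ho, .refl⟩
  | @trap_start _ b i p o h =>
    exact exists_step_of_le (fun x => colors b j (.trap (p.setIn x)) o) hj
      (.trap_start (h.trans_le hj))
      fun hlt => by simpa using Step.trap_start (p := p.setIn i) (by simpa using hlt)
  | trap_ctx h => exact ⟨_, .trap_ctx h, .refl⟩
  | trap_end h => exact ⟨_, .trap_end h, .refl⟩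
  | @shift_start _ b i p o h =>
    exact exists_step_of_le (fun x => colors b j (.shift (p.setIn x)) o) hj
      (.shift_start (h.trans_le hj))
      fun hlt => by simpa using Step.shift_start (p := p.setIn i) (by simpa using hlt)
  | shift_ctx h => exact ⟨_, .shift_ctx h, .refl⟩
  | shift_end h => exact ⟨_, .shift_end h, .refl⟩
  | @suspend_go _ b i s p o h =>
    exact exists_step_of_le (fun x => colors b j (.suspend s (p.setGo x)) o) hj.1
      (.suspend_go (h.trans_le hj.1))
      fun hlt => by simpa using Step.suspend_go (p := p.setGo i.go) (by simpa using hlt)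
  | @suspend_res _ b i s p o h =>
    have hle := suspRes_mono E hj s p
    refine exists_step_of_le (fun x => colors b j (.suspend s (p.setRes x)) o) hle
      (.suspend_res (h.trans_le hle)) fun hlt => ?_
    -- the value computed by the gate does not change, as it reads only the Sel value of `p`
    have hsel (x : SBool) : suspRes E j s (p.setRes x) = suspRes E j s p := by simp [suspRes]
    simpa [hsel] using Step.suspend_res (sync := sync) (E := E) (b := b) (i := j) (s := s) (o := o)
      (p := p.setRes (suspRes E i s p)) (by simpa [hsel] using hlt)
  | @suspend_susp _ b i s p o h =>
    have hle := suspSusp_mono E hj s p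
    refine exists_step_of_le (fun x => colors b j (.suspend s (p.setSusp x)) o) hle
      (.suspend_susp (h.trans_le hle)) fun hlt => ?_
    have hsel (x : SBool) : suspSusp E j s (p.setSusp x) = suspSusp E j s p := by
      simp [suspSusp]
    simpa [hsel] using Step.suspend_susp (sync := sync) (E := E) (b := b) (i := j) (s := s) (o := o)
      (p := p.setSusp (suspSusp E i s p)) (by simpa [hsel] using hlt)
  | suspend_ctx h => exact ⟨_, .suspend_ctx h, .refl⟩
  | suspend_end_bot h => exact ⟨_, .suspend_end_bot h, .refl⟩
  | @suspend_end _ b i s p o h =>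
    have hle := suspNow_mono (suspSusp_mono E hj s p) p.out
    exact exists_step_of_le (colors b j (.suspend s p)) hle (.suspend_end (h.trans_le hle))
      fun hlt => .suspend_end hlt
  | @ite_go_left _ b i s p q o h =>
    have hle := SBool.and_mono hj.1 (le_refl (E.status s))
    exact exists_step_of_le (fun x => colors b j (.ite s (p.setGo x) q) o) hle
      (.ite_go_left (h.trans_le hle))
      fun hlt => by simpa using Step.ite_go_left (p := p.setGo _) (by simpa using hlt)
  | @ite_go_right _ b i s p q o h =>
    have hle := SBool.and_mono hj.1 (le_refl (E.status s).not)
    exact exists_step_of_le (fun x => colors b j (.ite s p (q.setGo x)) o) hle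
      (.ite_go_right (h.trans_le hle))
      fun hlt => by simpa using Step.ite_go_right (q := q.setGo _) (by simpa using hlt)
  | @ite_res_left _ b i s p q o h =>
    exact exists_step_of_le (fun x => colors b j (.ite s (p.setRes x) q) o) hj.2.1
      (.ite_res_left (h.trans_le hj.2.1))
      fun hlt => by simpa using Step.ite_res_left (p := p.setRes i.res) (by simpa using hlt)
  | @ite_res_right _ b i s p q o h =>
    exact exists_step_of_le (fun x => colors b j (.ite s p (q.setRes x)) o) hj.2.1
      (.ite_res_right (h.trans_le hj.2.1))
      fun hlt => by simpa using Step.ite_res_right (q := q.setRes i.res) (by simpa using hlt)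
  | @ite_susp_left _ b i s p q o h =>
    exact exists_step_of_le (fun x => colors b j (.ite s (p.setSusp x) q) o) hj.2.2
      (.ite_susp_left (h.trans_le hj.2.2))
      fun hlt => by simpa using Step.ite_susp_left (p := p.setSusp i.susp) (by simpa using hlt)
  | @ite_susp_right _ b i s p q o h =>
    exact exists_step_of_le (fun x => colors b j (.ite s p (q.setSusp x)) o) hj.2.2
      (.ite_susp_right (h.trans_le hj.2.2))
      fun hlt => by simpa using Step.ite_susp_right (q := q.setSusp i.susp) (by simpa using hlt)
  | ite_ctx_left h => exact ⟨_, .ite_ctx_left h, .refl⟩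
  | ite_ctx_right h => exact ⟨_, .ite_ctx_right h, .refl⟩
  | ite_end h => exact ⟨_, .ite_end h, .refl⟩
  | @seq_start _ b i p q o h =>
    exact exists_step_of_le (fun x => colors b j (.seq (p.setIn x) q) o) hj
      (.seq_start (h.trans_le hj))
      fun hlt => by simpa using Step.seq_start (p := p.setIn i) (by simpa using hlt)
  | @seq_res _ b i p q o h =>
    exact exists_step_of_le (fun x => colors b j (.seq p (q.setRes x)) o) hj.2.1
      (.seq_res (h.trans_le hj.2.1))
      fun hlt => by simpa using Step.seq_res (q := q.setRes i.res) (by simpa using hlt)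
  | @seq_susp _ b i p q o h =>
    exact exists_step_of_le (fun x => colors b j (.seq p (q.setSusp x)) o) hj.2.2
      (.seq_susp (h.trans_le hj.2.2))
      fun hlt => by simpa using Step.seq_susp (q := q.setSusp i.susp) (by simpa using hlt)
  | seq_go ho hq => exact ⟨_, .seq_go ho hq, .refl⟩
  | seq_nogo ho hq => exact ⟨_, .seq_nogo ho hq, .refl⟩
  | seq_ctx_left h => exact ⟨_, .seq_ctx_left h, .refl⟩
  | seq_ctx_right h => exact ⟨_, .seq_ctx_right h, .refl⟩
  | seq_end h => exact ⟨_, .seq_end h, .refl⟩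
  | @par_start_left _ b i p q o h =>
    exact exists_step_of_le (fun x => colors b j (.par (p.setIn x) q) o) hj
      (.par_start_left (h.trans_le hj))
      fun hlt => by simpa using Step.par_start_left (p := p.setIn i) (by simpa using hlt)
  | @par_start_right _ b i p q o h =>
    exact exists_step_of_le (fun x => colors b j (.par p (q.setIn x)) o) hj
      (.par_start_right (h.trans_le hj))
      fun hlt => by simpa using Step.par_start_right (q := q.setIn i) (by simpa using hlt)
  | par_ctx_left h => exact ⟨_, .par_ctx_left h, .refl⟩
  | par_ctx_right h => exact ⟨_, .par_ctx_right h, .refl⟩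
  | par_end h => exact ⟨_, .par_end h, .refl⟩
  | @signal_start _ b i s p o h =>
    exact exists_step_of_le (fun x => colors b j (.signal s (p.setIn x)) o) hj
      (.signal_start (h.trans_le hj))
      fun hlt => by simpa using Step.signal_start (p := p.setIn i) (by simpa using hlt)
  | signal_ctx h => exact ⟨_, .signal_ctx h, .refl⟩
  | signal_end h => exact ⟨_, .signal_end h, .refl⟩

end

end Esterel

theorem mainTheorem7 {S : Type*} [DecidableEq S] (sync : Esterel.Synchronizer) :
    -- the base statement and the Sel values do not change
    (∀ (E : Esterel.Event S) (p p' : Esterel.MState S), Esterel.Step sync E p p' →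
      p.base = p'.base ∧ p.sels = p'.sels) ∧
    -- the input color does not change
    (∀ (E : Esterel.Event S) (p p' : Esterel.MState S), Esterel.Step sync E p p' →
      p.inp = p'.inp) ∧
    -- each microstep increases information
    (∀ (E : Esterel.Event S) (p p' : Esterel.MState S), Esterel.Step sync E p p' → p < p') ∧
    -- total microstates cannot reduce
    (∀ (E : Esterel.Event S) (p : Esterel.MState S), p.Total →
      ¬ ∃ p', Esterel.Step sync E p p') ∧
    -- a microstep is local
    (∀ (E : Esterel.Event S) (p p' : Esterel.MState S), Esterel.Step sync E p p' →
      p.cmd = p'.cmd ∨ p.out = p'.out) ∧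
    -- compatibility with `<` and `≤` on input colors
    (∀ (E : Esterel.Event S) (p p' : Esterel.MState S) (i : Esterel.InColor), p.inp < i →
      Esterel.Step sync E p p' →
      ∃ p'', Esterel.Step sync E (p.setIn i) p'' ∧ p' < p'' ∧
        Esterel.Steps sync E (p'.setIn i) p'') ∧
    (∀ (E : Esterel.Event S) (p p' : Esterel.MState S) (i : Esterel.InColor), p.inp ≤ i →
      Esterel.Step sync E p p' →
      ∃ p'', Esterel.Step sync E (p.setIn i) p'' ∧ p' ≤ p'' ∧
        Esterel.Steps sync E (p'.setIn i) p'') := by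
  refine ⟨fun E p p' h => Esterel.MState.base_sels_eq_of_le h.lt.le, fun E p p' h => h.inp_eq,
    fun E p p' h => h.lt, fun E p hp ⟨p', h⟩ => hp.not_lt h.lt,
    fun E p p' h => h.cmd_eq_or_out_eq, fun E p p' i hi h => ?_, fun E p p' i hi h => ?_⟩
  · obtain ⟨p'', h₁, h₂⟩ := h.exists_setIn hi.le
    exact ⟨p'', h₁, (Esterel.MState.lt_setIn (h.inp_eq ▸ hi)).trans_le h₂.le, h₂⟩
  · obtain ⟨p'', h₁, h₂⟩ := h.exists_setIn hi
    exact ⟨p'', h₁, (Esterel.MState.le_setIn (h.inp_eq ▸ hi)).trans h₂.le, h₂⟩
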